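/- Let $G$ be a (finite-dimensional, real, smooth) Lie group with Lie algebra $\mathfrak g$, let $V\subseteq\mathfrak g$ be a linear subspace that generates $\mathfrak g$ as a Lie algebra, and let $\|\cdot\|$ be a norm on $V$; so $(G,V,\|\cdot\|)$ is a sub-Finsler Lie group. Let $\mathrm E(v):=\tfrac12\|v\|^2$ for $v\in V$, and let $$\partial_u\mathrm E:=\{\eta\in V^*:\ \eta(v-u)\le \mathrm E(v)-\mathrm E(u)\ \text{ for all } v\in V\}$$ be its subdifferential at $u\in V$. A curve $\gamma:I\to G$ on an interval $I\subseteq\mathbb R$ is called a normal curve with associated covector $\lambda\in\mathfrak g^*$ if it is absolutely continuous on compact subintervals of $I$, there is a measurable control $u:I\to V$, square integrable on every bounded part of $I$, with $\dot\gamma(t)=\mathrm dL_{\gamma(t)}u(t)$ for a.e. $t\in I$ (where $L_x$ denotes left translation by $x$), and $$\lambda\circ \mathrm{Ad}_{\gamma(t)}|_V\in\partial_{u(t)}\mathrm E\qquad\text{for a.e. } t\in I .$$ Then for every $\lambda\in\mathfrak g^*$ and every $g\in G$ there exists a normal curve $\gamma:\mathbb R\to G$ with $\gamma(0)=g$ and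 with associated covector $\lambda$. -/

import Mathlib

open Set Filter MeasureTheory
open scoped Manifold ContDiff Topology

noncomputable section

/-- Over `ℝ`, a smooth Lie group has the finite smoothness that Mathlib asks for when it
builds the Lie bracket on `GroupLieAlgebra I G`. -/
instance instLEInftyMinSmoothnessThree : ENat.LEInfty (minSmoothness ℝ 3) :=
  ⟨by rw [minSmoothness_of_isRCLikeNormedField]; exact ENat.LEInfty.out⟩

/-- The subdifferential of `f` at `u`: all linear functionals `η` such that
`η (v - u) ≤ f v - f u` for all `v`. It is used on finite-dimensional spaces only, where every
linear functional is continuous. -/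
def subdifferential {W : Type*} [AddCommGroup W] [Module ℝ W] (f : W → ℝ) (u : W) :
    Set (Module.Dual ℝ W) :=
  {η | ∀ v : W, η (v - u) ≤ f v - f u}

section LieGroups

variable {E : Type*} [NormedAddCommGroup E] [NormedSpace ℝ E]
  {H : Type*} [TopologicalSpace H] (I : ModelWithCorners ℝ E H)
  (G : Type*) [TopologicalSpace G] [ChartedSpace H G] [Group G]

/-- A sub-Finsler structure on the Lie group `G`: a bracket-generating linear subspace of the
Lie algebra (the polarization) and a norm on it. -/
structure SubFinslerStructure [CompleteSpace E] [LieGroup I ∞ G] where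
  /-- The polarization `V`. -/
  polarization : Submodule ℝ (GroupLieAlgebra I G)
  /-- The Lie subalgebra generated by `V` is the whole Lie algebra. -/
  bracketGenerating :
    LieSubalgebra.lieSpan ℝ (GroupLieAlgebra I G) (polarization : Set (GroupLieAlgebra I G)) = ⊤
  /-- The norm on `V`, as a seminorm which is definite by the next field. -/
  norm : Seminorm ℝ polarization
  norm_definite : ∀ v : polarization, norm v = 0 → v = 0

variable {G}

/-- The adjoint map `Ad g`, the differential at the identity of the conjugation by `g`.
The differential takes values in the tangent space at `g * 1 * g⁻¹`, which is the Lie algebra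
because `g * 1 * g⁻¹ = 1`. -/
def lieAd (g : G) : GroupLieAlgebra I G →ₗ[ℝ] GroupLieAlgebra I G :=
  (mfderiv I I (fun x : G => g * x * g⁻¹) (1 : G) : E →L[ℝ] E).toLinearMap

/-- The curve `γ` is absolutely continuous on (compact subintervals of) the interval `J`:
every point of `J` has a compact interval `[a, b] ⊆ J` as a neighbourhood in `J`
on which `γ` stays in a chart and is absolutely continuous when read in this chart. -/
def IsLocallyACOn (γ : ℝ → G) (J : Set ℝ) : Prop :=
  ∀ t ∈ J, ∃ a b : ℝ, Icc a b ⊆ J ∧ Icc a b ∈ 𝓝[J] t ∧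
    MapsTo γ (Icc a b) (chartAt H (γ t)).source ∧
    AbsolutelyContinuousOnInterval (fun s => extChartAt I (γ t) (γ s)) a b

namespace SubFinslerStructure

variable {I} [CompleteSpace E] [LieGroup I ∞ G] (S : SubFinslerStructure I G)

/-- The energy `v ↦ ‖v‖² / 2` on the polarization. -/
def energy (v : S.polarization) : ℝ := S.norm v ^ 2 / 2

/-- `γ` is a horizontal curve on the interval `J`, with control `u`: it is absolutely continuous
and its derivative at almost every `t ∈ J` is the image of `u t ∈ V` under the differential at
the identity of the left translation by `γ t`. -/
def IsHorizontalWithControl (γ : ℝ → G) (J : Set ℝ) (u : ℝ → S.polarization) : Prop :=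
  J.OrdConnected ∧ IsLocallyACOn I γ J ∧
    ∀ᵐ t ∂(volume.restrict J), HasMFDerivAt 𝓘(ℝ, ℝ) I γ t
      ((1 : ℝ →L[ℝ] ℝ).smulRight
        (mulInvariantVectorField (u t : GroupLieAlgebra I G) (γ t)))

/-- The control `u` is square integrable on every bounded part of the interval `J`. If `J` is
bounded then this says `u ∈ L²(J, V)`. -/
def IsSquareIntegrableControl (u : ℝ → S.polarization) (J : Set ℝ) : Prop :=
  ∀ a b : ℝ, AEStronglyMeasurable u (volume.restrict (J ∩ Icc a b)) ∧
    MemLp (fun t => S.norm (u t)) 2 (volume.restrict (J ∩ Icc a b))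

/-- `γ` is a normal curve on the interval `J` and `lam` is a covector associated to it:
`γ` is horizontal with a square integrable control `u`, and for almost every `t ∈ J` the
restriction of `lam ∘ Ad (γ t)` to `V` lies in the subdifferential of the energy at `u t`. -/
def IsNormalCurveWithCovector (γ : ℝ → G) (J : Set ℝ)
    (lam : Module.Dual ℝ (GroupLieAlgebra I G)) : Prop :=
  ∃ u : ℝ → S.polarization,
    S.IsHorizontalWithControl γ J u ∧ S.IsSquareIntegrableControl u J ∧
    ∀ᵐ t ∂(volume.restrict J),
      (lam ∘ₗ lieAd I (γ t)) ∘ₗ S.polarization.subtype ∈ subdifferential S.energy (u t)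

end SubFinslerStructure

end LieGroups

end

section Krasovskii

open scoped NNReal

variable {Z : Type*} [NormedAddCommGroup Z] [NormedSpace ℝ Z]

/-- The nodes of the Euler scheme with step `ε` for the field `f`. -/
def eulerNode (f : Z → Z) (z₀ : Z) (ε : ℝ) : ℕ → Z
  | 0 => z₀
  | k + 1 => eulerNode f z₀ ε k + ε • f (eulerNode f z₀ ε k)

variable [FiniteDimensional ℝ Z]

theorem exists_euler_curve (f : Z → Z) (C : ℝ≥0) (hf : ∀ z, ‖f z‖ ≤ C) (z₀ : Z) {ε : ℝ}
    (hε : 0 < ε) :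
    ∃ z : ℝ → Z, LipschitzWith C z ∧ z 0 = z₀ ∧ ∀ S : Set Z, Convex ℝ S → IsClosed S →
      ∀ s t : ℝ, 0 ≤ s → s < t → (∀ τ ∈ Icc (s - ε) t, f (z τ) ∈ S) →
        (t - s)⁻¹ • (z t - z s) ∈ S := by
  have : CompleteSpace Z := FiniteDimensional.complete ℝ Z
  set x := eulerNode f z₀ ε with hx
  set φ : ℝ → Z := fun s => f (x ⌊s / ε⌋₊) with hφ
  have hφm : StronglyMeasurable φ := by
    have h1 : StronglyMeasurable (fun k : ℕ => f (x k)) := .of_discrete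
    exact h1.comp_measurable (Nat.measurable_floor.comp (measurable_id.div_const ε))
  have hφb : ∀ s, ‖φ s‖ ≤ C := fun s => hf _
  have hφi : ∀ a b : ℝ, IntervalIntegrable φ volume a b := fun a b =>
    (intervalIntegrable_const (c := (C : ℝ))).mono_fun hφm.aestronglyMeasurable
      (Eventually.of_forall fun s => by simpa using hφb s)
  set z : ℝ → Z := fun t => z₀ + ∫ s in (0 : ℝ)..t, φ s with hz
  have hsub : ∀ s t, z t - z s = ∫ τ in s..t, φ τ := fun s t => by
    simp only [hz, add_sub_add_left_eq_sub]
    exact intervalIntegral.integral_interval_sub_left (hφi _ _) (hφi _ _)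
  have hnode : ∀ k : ℕ, z (k * ε) = x k := by
    intro k
    induction k with
    | zero => simp [hz, hx, eulerNode]
    | succ k ih =>
      have h1 : z ((k + 1 : ℕ) * ε) - z (k * ε) = ε • f (x k) := by
        rw [hsub, intervalIntegral.integral_of_le (by push_cast; nlinarith),
          integral_Ioc_eq_integral_Ioo,
          setIntegral_congr_fun (g := fun _ => f (x k)) measurableSet_Ioo]
        · rw [setIntegral_const, Measure.real, Real.volume_Ioo,
            ENNReal.toReal_ofReal (by push_cast; nlinarith)]
          congr 1
          push_cast
          ring
        · intro s hs
          have h2 : ⌊s / ε⌋₊ = k := by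
            have h3 : (k : ℝ) ≤ s / ε := (le_div_iff₀ hε).2 hs.1.le
            rw [Nat.floor_eq_iff (k.cast_nonneg.trans h3)]
            refine ⟨h3, (div_lt_iff₀ hε).2 ?_⟩
            simpa using hs.2
          simp only [hφ, h2]
      rw [ih] at h1
      rw [sub_eq_iff_eq_add.1 h1, add_comm]
      simp [hx, eulerNode]
  refine ⟨z, ?_, by simp [hz], ?_⟩
  · refine LipschitzWith.of_dist_le_mul fun t s => ?_
    rw [dist_eq_norm, hsub, Real.dist_eq]
    exact intervalIntegral.norm_integral_le_of_norm_le_const fun τ _ => hφb τ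
  · intro S hS hSc s t hs hst h
    have hμ : volume (Ioc s t) ≠ 0 := by simp [hst]
    have hμ' : volume (Ioc s t) ≠ ⊤ := by simp
    have key := hS.set_average_mem hSc hμ hμ' (f := φ) (μ := volume) ?_ ?_
    · rw [hsub, intervalIntegral.integral_of_le hst.le]
      rw [setAverage_eq, Measure.real, Real.volume_Ioc, ENNReal.toReal_ofReal (by linarith)] at key
      exact key
    · refine (ae_restrict_iff' measurableSet_Ioc).2 (Eventually.of_forall fun τ hτ => ?_)
      simp only [hφ]
      rw [← hnode]
      have h0 : 0 ≤ τ / ε := div_nonneg (hs.trans hτ.1.le) hε.le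
      have h1 : (⌊τ / ε⌋₊ : ℝ) * ε ≤ τ := by
        rw [← le_div_iff₀ hε]; exact Nat.floor_le h0
      have h2 : τ < (⌊τ / ε⌋₊ + 1 : ℝ) * ε := by
        rw [← div_lt_iff₀ hε]; exact Nat.lt_floor_add_one _
      exact h _ ⟨by linarith [hτ.1], by linarith [hτ.2]⟩
    · exact (hφi s t).1

/-- Existence of Krasovskii solutions: every bounded vector field has, through every point,
a Lipschitz curve whose velocity lies in the closed convex hull of the nearby values. -/
theorem exists_krasovskii_solution (f : Z → Z) (C : ℝ≥0) (hf : ∀ z, ‖f z‖ ≤ C) (z₀ : Z) :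
    ∃ z : ℝ → Z, LipschitzWith C z ∧ z 0 = z₀ ∧ ∀ t, 0 ≤ t → ∀ v, HasDerivAt z v t →
      ∀ S : Set Z, Convex ℝ S → IsClosed S → (∀ᶠ w in 𝓝 (z t), f w ∈ S) → v ∈ S := by
  choose ζ hζL hζ0 hζS using fun n : ℕ =>
    exists_euler_curve f C hf z₀ (ε := 1 / ((n : ℝ) + 1)) (by positivity)
  let 𝓤 : Ultrafilter ℕ := hyperfilter ℕ
  have h𝓤 : (𝓤 : Filter ℕ) ≤ atTop := Nat.hyperfilter_le_atTop
  have hlim : ∀ t, ∃ w, Tendsto (fun n => ζ n t) 𝓤 (𝓝 w) := by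
    intro t
    have hK : IsCompact (Metric.closedBall z₀ (C * |t|)) := isCompact_closedBall _ _
    obtain ⟨w, -, hw⟩ := hK.ultrafilter_le_nhds (𝓤.map fun n => ζ n t) (by
      rw [le_principal_iff]
      refine Filter.Eventually.of_forall (f := (𝓤 : Filter ℕ)) fun n => ?_
      have := (hζL n).dist_le_mul t 0
      rw [hζ0, Real.dist_eq, sub_zero] at this
      exact this)
    exact ⟨w, hw⟩
  choose z hz using hlim
  refine ⟨z, ?_, ?_, ?_⟩
  · refine LipschitzWith.of_dist_le_mul fun t s => ?_
    exact le_of_tendsto ((hz t).dist (hz s)) (Eventually.of_forall fun n => (hζL n).dist_le_mul t s)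
  · exact tendsto_nhds_unique (hz 0) (by simp [hζ0])
  · intro t ht v hv S hS hSc hev
    obtain ⟨η, hη, hball⟩ := Metric.eventually_nhds_iff.1 hev
    have hC : (0 : ℝ) ≤ C := C.2
    set d : ℝ := η / (4 * (C + 1)) with hd
    have hdpos : 0 < d := by positivity
    have hCd : C * d ≤ η / 4 := by
      rw [hd, mul_div_assoc', div_le_div_iff₀ (by positivity) (by norm_num)]
      nlinarith
    have hslope : ∀ s ∈ Ioo t (t + d), (s - t)⁻¹ • (z s - z t) ∈ S := by
      intro s hs
      have h1 : Tendsto (fun n => (s - t)⁻¹ • (ζ n s - ζ n t)) 𝓤 (𝓝 ((s - t)⁻¹ • (z s - z t))) :=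
        ((hz s).sub (hz t)).const_smul _
      refine hSc.mem_of_tendsto h1 ?_
      have h2 : ∀ᶠ n in (𝓤 : Filter ℕ), dist (ζ n t) (z t) < η / 2 :=
        (hz t).eventually (Metric.ball_mem_nhds _ (by positivity))
      have h3 : ∀ᶠ n : ℕ in (𝓤 : Filter ℕ), 1 / ((n : ℝ) + 1) < d :=
        h𝓤 (tendsto_one_div_add_atTop_nhds_zero_nat.eventually (gt_mem_nhds hdpos))
      filter_upwards [h2, h3] with n hn2 hn3
      refine hζS n S hS hSc t s ht hs.1 fun τ hτ => hball ?_
      have h4 : dist (ζ n τ) (ζ n t) ≤ η / 4 := by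
        refine ((hζL n).dist_le_mul τ t).trans (le_trans ?_ hCd)
        refine mul_le_mul_of_nonneg_left ?_ hC
        rw [Real.dist_eq, abs_le]
        constructor <;> linarith [hτ.1, hτ.2, hs.2]
      linarith [dist_triangle (ζ n τ) (ζ n t) (z t)]
    have h5 := hasDerivAt_iff_tendsto_slope.1 hv
    refine hSc.mem_of_tendsto (h5.mono_left (nhdsGT_le_nhdsNE t)) ?_
    filter_upwards [Ioo_mem_nhdsGT (show t < t + d by linarith)] with s hs
    exact hslope s hs

end Krasovskii

section MaximizingControl

open scoped NNReal

variable {E V : Type*} [NormedAddCommGroup E] [NormedSpace ℝ E] [FiniteDimensional ℝ E]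
  [NormedAddCommGroup V] [NormedSpace ℝ V] [FiniteDimensional ℝ V]

/-- Existence for `y' = A(y) p` where the control `p` maximizes `ℓ(y)` over a convex compact set:
continuous data with bounded `A`. -/
theorem exists_maximizing_control_of_bounded {K : Set V} (hKc : IsCompact K) (hKn : K.Nonempty)
    (hKconv : Convex ℝ K) {A : E → V →L[ℝ] E} (hA : Continuous A) {C R : ℝ≥0}
    (hAC : ∀ y, ‖A y‖ ≤ C) (hR : ∀ p ∈ K, ‖p‖ ≤ R)
    {ℓ : E → V →L[ℝ] ℝ} (hℓ : Continuous ℓ) (e : E) :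
    ∃ (y : ℝ → E) (p : ℝ → V), LipschitzWith (max (C * R) R) y ∧ y 0 = e ∧
      StronglyMeasurable p ∧ ∀ᵐ t : ℝ, 0 ≤ t →
        p t ∈ K ∧ HasDerivAt y (A (y t) (p t)) t ∧ ∀ q ∈ K, ℓ (y t) q ≤ ℓ (y t) (p t) := by
  have hmax : ∀ y, ∃ p ∈ K, ∀ q ∈ K, ℓ y q ≤ ℓ y p := fun y =>
    hKc.exists_isMaxOn hKn (ℓ y).continuous.continuousOn
  choose π hπK hπ using hmax
  have hCR : ∀ x, ∀ p ∈ K, ‖A x p‖ ≤ C * R := fun x p hp =>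
    (A x).le_of_opNorm_le_of_le (hAC x) (hR p hp)
  obtain ⟨z, hzL, hz0, hz⟩ := exists_krasovskii_solution (Z := E × V)
    (fun w => (A w.1 (π w.1), π w.1)) (max (C * R) R)
    (fun w => by
      rw [Prod.norm_def, NNReal.coe_max]
      exact max_le_max (by simpa using hCR _ _ (hπK _)) (hR _ (hπK _))) (e, 0)
  have hyL : LipschitzWith (max (C * R) R) fun t => (z t).1 := by
    simpa [Function.comp_def] using LipschitzWith.prod_fst.comp hzL
  refine ⟨fun t => (z t).1, deriv fun t => (z t).2, hyL, by simp [hz0],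
    stronglyMeasurable_deriv _, ?_⟩
  filter_upwards [hzL.ae_differentiableAt_real] with t ht ht0
  have hd := ht.hasDerivAt
  have hd1 : HasDerivAt (fun t => (z t).1) (deriv z t).1 t :=
    (ContinuousLinearMap.fst ℝ E V).hasFDerivAt.comp_hasDerivAt t hd
  have hd2 : HasDerivAt (fun t => (z t).2) (deriv z t).2 t :=
    (ContinuousLinearMap.snd ℝ E V).hasFDerivAt.comp_hasDerivAt t hd
  have hmem := hz t ht0 _ hd
  rw [hd2.deriv]
  set v := deriv z t with hv
  set Y := (z t).1 with hY
  have hcont : Tendsto (fun w : E × V => w.1) (𝓝 (z t)) (𝓝 Y) := continuous_fst.tendsto _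
  have hK : v.2 ∈ K :=
    hmem (Prod.snd ⁻¹' K) (hKconv.linear_preimage (LinearMap.snd ℝ E V))
      (hKc.isClosed.preimage continuous_snd) (Eventually.of_forall fun w => hπK _)
  refine ⟨hK, ?_, fun q hq => ?_⟩
  · have : v.1 = A Y v.2 := by
      rw [← sub_eq_zero, ← norm_le_zero_iff]
      refine le_of_forall_pos_le_add fun η hη => ?_
      rw [zero_add]
      let T : E × V →L[ℝ] E :=
        ContinuousLinearMap.fst ℝ E V - (A Y).comp (ContinuousLinearMap.snd ℝ E V)
      refine mem_closedBall_zero_iff.1 (hmem (T ⁻¹' Metric.closedBall 0 η)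
        ((convex_closedBall 0 η).linear_preimage T.toLinearMap)
        (Metric.isClosed_closedBall.preimage T.continuous) ?_)
      have h1 : ∀ᶠ x in 𝓝 Y, ‖A x - A Y‖ < η / (R + 1) := by
        have := (hA.tendsto Y).eventually (Metric.ball_mem_nhds (A Y) (ε := η / (R + 1))
          (by positivity))
        simpa [dist_eq_norm] using this
      filter_upwards [hcont.eventually h1] with w hw
      rw [mem_preimage, mem_closedBall_zero_iff]
      have h2 : ‖(A w.1 - A Y) (π w.1)‖ ≤ η / (R + 1) * (R + 1) :=
        (A w.1 - A Y).le_of_opNorm_le_of_le hw.le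
          ((hR _ (hπK _)).trans (by linarith))
      rw [div_mul_cancel₀ _ (by positivity)] at h2
      simpa [T] using h2
    rw [← this]
    exact hd1
  · refine le_of_forall_pos_le_add fun η hη => ?_
    let T : E × V →L[ℝ] ℝ := (ℓ Y).comp (ContinuousLinearMap.snd ℝ E V)
    refine hmem (T ⁻¹' {c | ℓ Y q ≤ c + η})
        (Convex.linear_preimage (s := {c | ℓ Y q ≤ c + η}) ?_ T.toLinearMap)
        (IsClosed.preimage T.continuous (isClosed_le continuous_const (by fun_prop))) ?_
    · have : {c | ℓ Y q ≤ c + η} = Ici (ℓ Y q - η) := by ext; simp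
      rw [this]
      exact convex_Ici _
    · have h1 : ∀ᶠ x in 𝓝 Y, ‖ℓ x - ℓ Y‖ < η / (2 * (R + 1)) := by
        have := (hℓ.tendsto Y).eventually (Metric.ball_mem_nhds (ℓ Y) (ε := η / (2 * (R + 1)))
          (by positivity))
        simpa [dist_eq_norm] using this
      filter_upwards [hcont.eventually h1] with w hw
      have h2 : ∀ p ∈ K, |ℓ w.1 p - ℓ Y p| ≤ η / 2 := by
        intro p hp
        have h3 : ‖(ℓ w.1 - ℓ Y) p‖ ≤ η / (2 * (R + 1)) * (R + 1) :=
          (ℓ w.1 - ℓ Y).le_of_opNorm_le_of_le hw.le ((hR _ hp).trans (by linarith))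
        have h4 : η / (2 * ((R : ℝ) + 1)) * (R + 1) = η / 2 := by
          field_simp
        rw [h4] at h3
        simpa using h3
      have h5 := abs_le.1 (h2 q hq)
      have h6 := abs_le.1 (h2 _ (hπK w.1))
      have h7 := hπ w.1 q hq
      change ℓ Y q ≤ ℓ Y (π w.1) + η
      linarith [h5.1, h6.2]

/-- The radial retraction onto the ball of radius `ρ` around `e`. -/
noncomputable def ballRetraction (e : E) (ρ : ℝ) (x : E) : E :=
  e + (ρ / max ρ ‖x - e‖) • (x - e)

omit [FiniteDimensional ℝ E] in
theorem continuous_ballRetraction (e : E) {ρ : ℝ} (hρ : 0 < ρ) :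
    Continuous (ballRetraction e ρ) := by
  unfold ballRetraction
  refine continuous_const.add (Continuous.smul (continuous_const.div (by fun_prop) fun x => ?_)
    (by fun_prop))
  exact (lt_max_of_lt_left hρ).ne'

omit [FiniteDimensional ℝ E] in
theorem ballRetraction_mem (e : E) {ρ : ℝ} (hρ : 0 < ρ) (x : E) :
    ballRetraction e ρ x ∈ Metric.closedBall e ρ := by
  have h : 0 < max ρ ‖x - e‖ := lt_max_of_lt_left hρ
  rw [mem_closedBall_iff_norm, ballRetraction, add_sub_cancel_left, norm_smul, Real.norm_eq_abs,
    abs_of_pos (by positivity), div_mul_eq_mul_div, div_le_iff₀ h]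
  exact mul_le_mul_of_nonneg_left (le_max_right _ _) hρ.le

omit [FiniteDimensional ℝ E] in
theorem ballRetraction_of_mem {e : E} {ρ : ℝ} (hρ : 0 < ρ) {x : E}
    (hx : x ∈ Metric.closedBall e ρ) : ballRetraction e ρ x = x := by
  rw [mem_closedBall_iff_norm] at hx
  rw [ballRetraction, max_eq_left hx, div_self hρ.ne', one_smul, add_sub_cancel]

/-- Local existence for `y' = A(y) p` where the control `p` maximizes `ℓ(y)` over a convex compact
set. The life time does not depend on `ℓ`. -/
theorem exists_maximizing_control {K : Set V} (hKc : IsCompact K) (hKn : K.Nonempty)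
    (hKconv : Convex ℝ K) {A : E → V →L[ℝ] E} {e : E} {ρ : ℝ} (hρ : 0 < ρ)
    (hA : ContinuousOn A (Metric.closedBall e ρ)) :
    ∃ δ > 0, ∀ ℓ : E → V →L[ℝ] ℝ, ContinuousOn ℓ (Metric.closedBall e ρ) →
      ∃ (y : ℝ → E) (p : ℝ → V) (C : ℝ≥0), LipschitzWith C y ∧ y 0 = e ∧
        (∀ t ∈ Icc 0 δ, y t ∈ Metric.closedBall e ρ) ∧ StronglyMeasurable p ∧
        ∀ᵐ t : ℝ, t ∈ Icc 0 δ →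
          p t ∈ K ∧ HasDerivAt y (A (y t) (p t)) t ∧ ∀ q ∈ K, ℓ (y t) q ≤ ℓ (y t) (p t) := by
  have hret := continuous_ballRetraction e hρ
  have hmem := ballRetraction_mem e hρ
  obtain ⟨C, hC⟩ := (isCompact_closedBall e ρ).exists_bound_of_continuousOn hA
  obtain ⟨R, hR⟩ := hKc.exists_bound_of_continuousOn continuousOn_id
  set M : ℝ≥0 := max (C.toNNReal * R.toNNReal) R.toNNReal with hM
  refine ⟨ρ / (M + 1), by positivity, fun ℓ hℓ => ?_⟩
  obtain ⟨y, p, hyL, hy0, hp, hae⟩ := exists_maximizing_control_of_bounded hKc hKn hKconv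
    (A := A ∘ ballRetraction e ρ) (C := C.toNNReal) (R := R.toNNReal)
    (ℓ := ℓ ∘ ballRetraction e ρ) (hA.comp_continuous hret hmem)
    (fun y => (hC _ (hmem y)).trans (Real.le_coe_toNNReal _))
    (fun q hq => (hR q hq).trans (Real.le_coe_toNNReal _)) (hℓ.comp_continuous hret hmem) e
  have hball : ∀ t ∈ Icc 0 (ρ / (M + 1)), y t ∈ Metric.closedBall e ρ := by
    intro t ht
    have h1 := hyL.dist_le_mul t 0
    rw [hy0, Real.dist_eq, sub_zero, abs_of_nonneg ht.1, ← hM] at h1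
    have h2 := (le_div_iff₀ (show (0 : ℝ) < M + 1 by positivity)).1 ht.2
    rw [Metric.mem_closedBall]
    nlinarith [ht.1]
  refine ⟨y, p, M, hyL, hy0, hball, hp, ?_⟩
  filter_upwards [hae] with t h ht
  simpa [ballRetraction_of_mem hρ (hball t ht)] using h ht.1

end MaximizingControl

noncomputable section LieGroupCharts

variable {E : Type*} [NormedAddCommGroup E] [NormedSpace ℝ E]
  {H : Type*} [TopologicalSpace H] (I : ModelWithCorners ℝ E H)
  (G : Type*) [TopologicalSpace G] [ChartedSpace H G] [Group G]

/-- The preferred chart at the identity. -/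
abbrev idChart : PartialEquiv G E := extChartAt I (1 : G)

/-- The coordinates of the identity in its preferred chart. -/
abbrev idCoord : E := extChartAt I (1 : G) 1

variable {G}

/-- The adjoint map, read in the chart at the identity. -/
def chartAd (g : G) : E →L[ℝ] E :=
  fderiv ℝ (fun z => idChart I G (g * (idChart I G).symm z * g⁻¹)) (idCoord I G)

variable (G) in
/-- The left invariant vector fields, read in the chart at the identity. -/
def chartLeftField (y : E) : E →L[ℝ] E :=
  fderiv ℝ (fun z => idChart I G ((idChart I G).symm y * (idChart I G).symm z)) (idCoord I G)

variable (G) in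
/-- The conjugation, read in the chart at the identity. -/
def chartConj (w : E × E) : E :=
  idChart I G ((idChart I G).symm w.1 * (idChart I G).symm w.2 * ((idChart I G).symm w.1)⁻¹)

/-- The curve `γ` has at time `t` a derivative, which is the left translate of `u`. -/
def HasLeftVelocityAt (γ : ℝ → G) (u : E) (t : ℝ) : Prop :=
  ContinuousAt γ t ∧ HasDerivAt (fun s => idChart I G ((γ t)⁻¹ * γ s)) u t

variable [I.Boundaryless] [LieGroup I ∞ G]

omit [LieGroup I ∞ G] [I.Boundaryless] in
theorem idChart_symm_idCoord : (idChart I G).symm (idCoord I G) = 1 := extChartAt_to_inv 1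

omit [LieGroup I ∞ G] [I.Boundaryless] in
theorem one_mem_idChart_source : (1 : G) ∈ (idChart I G).source := mem_extChartAt_source 1

omit [LieGroup I ∞ G] in
theorem idChart_target_mem_nhds {y : E} (hy : y ∈ (idChart I G).target) :
    (idChart I G).target ∈ 𝓝 y := (isOpen_extChartAt_target 1).mem_nhds hy

omit [LieGroup I ∞ G] [I.Boundaryless] in
theorem idCoord_mem_target : idCoord I G ∈ (idChart I G).target :=
  mem_extChartAt_target 1

theorem contMDiffAt_idChart_symm {y : E} (hy : y ∈ (idChart I G).target) :
    ContMDiffAt 𝓘(ℝ, E) I ∞ (idChart I G).symm y :=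
  haveI : IsManifold I ∞ G := inferInstance
  (contMDiffOn_extChartAt_symm (1 : G)).contMDiffAt (idChart_target_mem_nhds I hy)

variable {I}

omit [I.Boundaryless] in
theorem ContMDiffAt.contDiffAt_idChart {X : Type*} [NormedAddCommGroup X] [NormedSpace ℝ X]
    {F : X → G} {x : X} (hF : ContMDiffAt 𝓘(ℝ, X) I ∞ F x) (hx : F x ∈ (idChart I G).source) :
    ContDiffAt ℝ ∞ (fun w => idChart I G (F w)) x := by
  have : IsManifold I ∞ G := inferInstance
  rw [extChartAt_source] at hx
  exact ((contMDiffAt_extChartAt' hx).comp x hF).contDiffAt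

theorem ContDiffAt.contMDiffAt_idChart_symm_comp {X : Type*} [NormedAddCommGroup X]
    [NormedSpace ℝ X] {F : X → E} {x : X} (hF : ContDiffAt ℝ ∞ F x)
    (hx : F x ∈ (idChart I G).target) :
    ContMDiffAt 𝓘(ℝ, X) I ∞ (fun w => (idChart I G).symm (F w)) x :=
  (contMDiffAt_idChart_symm I hx).comp x hF.contMDiffAt

variable (I)

theorem contDiffAt_translate (a b : G) {y : E} (hy : y ∈ (idChart I G).target)
    (h : a * (idChart I G).symm y * b ∈ (idChart I G).source) :
    ContDiffAt ℝ ∞ (fun z => idChart I G (a * (idChart I G).symm z * b)) y :=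
  ContMDiffAt.contDiffAt_idChart
    ((contMDiffAt_const.mul (contMDiffAt_idChart_symm I hy)).mul contMDiffAt_const) h

theorem contDiffAt_chartConj : ContDiffAt ℝ ∞ (chartConj I G) (idCoord I G, idCoord I G) := by
  have h1 : ContMDiffAt 𝓘(ℝ, E × E) I ∞ (fun w : E × E => (idChart I G).symm w.1)
      (idCoord I G, idCoord I G) :=
    contDiffAt_fst.contMDiffAt_idChart_symm_comp (idCoord_mem_target I)
  have h2 : ContMDiffAt 𝓘(ℝ, E × E) I ∞ (fun w : E × E => (idChart I G).symm w.2)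
      (idCoord I G, idCoord I G) :=
    contDiffAt_snd.contMDiffAt_idChart_symm_comp (idCoord_mem_target I)
  refine ContMDiffAt.contDiffAt_idChart ((h1.mul h2).mul h1.inv) ?_
  simp only [idChart_symm_idCoord, mul_one, inv_one]
  exact one_mem_idChart_source I

theorem contDiffAt_chartMul :
    ContDiffAt ℝ ∞ (fun w : E × E => idChart I G ((idChart I G).symm w.1 * (idChart I G).symm w.2))
      (idCoord I G, idCoord I G) := by
  have h1 : ContMDiffAt 𝓘(ℝ, E × E) I ∞ (fun w : E × E => (idChart I G).symm w.1)
      (idCoord I G, idCoord I G) :=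
    contDiffAt_fst.contMDiffAt_idChart_symm_comp (idCoord_mem_target I)
  have h2 : ContMDiffAt 𝓘(ℝ, E × E) I ∞ (fun w : E × E => (idChart I G).symm w.2)
      (idCoord I G, idCoord I G) :=
    contDiffAt_snd.contMDiffAt_idChart_symm_comp (idCoord_mem_target I)
  refine ContMDiffAt.contDiffAt_idChart (h1.mul h2) ?_
  simp only [idChart_symm_idCoord, mul_one]
  exact one_mem_idChart_source I

end LieGroupCharts

section PartialDerivative

variable {E F : Type*} [NormedAddCommGroup E] [NormedSpace ℝ E]
  [NormedAddCommGroup F] [NormedSpace ℝ F]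

theorem eventually_hasFDerivAt_snd {f : E × E → F} {e : E} (hf : ContDiffAt ℝ ∞ f (e, e)) :
    ∀ᶠ y in 𝓝 e, HasFDerivAt (fun z => f (y, z))
      ((fderiv ℝ f (y, e)).comp (ContinuousLinearMap.inr ℝ E E)) e := by
  have h1 : ∀ᶠ w in 𝓝 (e, e), DifferentiableAt ℝ f w := by
    have h2 : ContDiffAt ℝ 1 f (e, e) := hf.of_le (by exact_mod_cast le_top)
    filter_upwards [h2.eventually (by simp)] with w hw using hw.differentiableAt (by simp)
  have h3 : Tendsto (fun y : E => (y, e)) (𝓝 e) (𝓝 (e, e)) :=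
    (by fun_prop : Continuous fun y : E => (y, e)).tendsto e
  filter_upwards [h3.eventually h1] with y hy
  exact hy.hasFDerivAt.comp e (hasFDerivAt_prodMk_right y e)

theorem contDiffAt_fderiv_snd {f : E × E → F} {e : E} (hf : ContDiffAt ℝ ∞ f (e, e)) :
    ContDiffAt ℝ 1 (fun y => fderiv ℝ (fun z => f (y, z)) e) e := by
  have h1 : ContDiffAt ℝ 1 (fderiv ℝ f) (e, e) :=
    hf.fderiv_right (by norm_num; exact ENat.LEInfty.out)
  have h2 : ContDiffAt ℝ 1 (fun y : E => (fderiv ℝ f (y, e)).comp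
      (ContinuousLinearMap.inr ℝ E E)) e :=
    ContDiffAt.clm_comp (ContDiffAt.comp e h1 (by fun_prop)) contDiffAt_const
  exact h2.congr_of_eventuallyEq ((eventually_hasFDerivAt_snd hf).mono fun y hy => hy.fderiv)

/-- If `f(x, x)`, `f(x, e)` and `f(e, x)` are affine near `e` then the mixed second derivative
of `f` at `(e, e)` is alternating. -/
theorem fderiv_fderiv_snd_self {f : E × E → F} {e : E} (hf : ContDiffAt ℝ ∞ f (e, e))
    {D₀ D₁ D₂ : E →L[ℝ] F} {c₀ c₁ c₂ : F}
    (h₀ : ∀ᶠ x in 𝓝 e, f (x, x) = D₀ x + c₀) (h₁ : ∀ᶠ x in 𝓝 e, f (x, e) = D₁ x + c₁)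
    (h₂ : ∀ᶠ x in 𝓝 e, f (e, x) = D₂ x + c₂) (u : E) :
    fderiv ℝ (fun y => fderiv ℝ (fun z => f (y, z)) e) e u u = 0 := by
  have hd : ContDiffAt ℝ 1 (fderiv ℝ f) (e, e) := hf.fderiv_right (by norm_num; exact ENat.LEInfty.out)
  have hQ : HasFDerivAt (fderiv ℝ f) (fderiv ℝ (fderiv ℝ f) (e, e)) (e, e) :=
    (hd.differentiableAt (by simp)).hasFDerivAt
  set Q := fderiv ℝ (fderiv ℝ f) (e, e) with hQdef
  have hsymm : ∀ a b, Q a b = Q b a := hf.isSymmSndFDerivAt (by simp; exact ENat.LEInfty.out)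
  have hev : ∀ᶠ w in 𝓝 (e, e), DifferentiableAt ℝ f w := by
    have h2 : ContDiffAt ℝ 1 f (e, e) := hf.of_le (by exact_mod_cast le_top)
    filter_upwards [h2.eventually (by simp)] with w hw using hw.differentiableAt (by simp)
  have hdiag : ∀ (J : E →L[ℝ] E × E) (k : E × E) (D : E →L[ℝ] F) (c : F), J e + k = (e, e) →
      (∀ᶠ x in 𝓝 e, f (J x + k) = D x + c) → ∀ u, Q (J u) (J u) = 0 := by
    intro J k D c hJ h u
    have hJ' : ∀ x, HasFDerivAt (fun x => J x + k) J x := fun x => J.hasFDerivAt.add_const k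
    have hcont : Tendsto (fun x => J x + k) (𝓝 e) (𝓝 (e, e)) := by
      have := (hJ' e).continuousAt.tendsto
      rwa [hJ] at this
    have h3 : (fun x => fderiv ℝ f (J x + k) (J u)) =ᶠ[𝓝 e] fun _ => D u := by
      filter_upwards [h.eventually_nhds, hcont.eventually hev] with x hx hfx
      have h4 : HasFDerivAt (fun x => f (J x + k)) ((fderiv ℝ f (J x + k)).comp J) x :=
        hfx.hasFDerivAt.comp x (hJ' x)
      have h5 : HasFDerivAt (fun x => f (J x + k)) D x :=
        (D.hasFDerivAt.add_const c).congr_of_eventuallyEq hx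
      exact congrArg (fun T : E →L[ℝ] F => T u) (h4.unique h5)
    have h6 : HasFDerivAt (fun x => fderiv ℝ f (J x + k)) (Q.comp J) e := by
      refine HasFDerivAt.comp e ?_ (hJ' e)
      rw [hJ]
      exact hQ
    have h7 := h6.clm_apply (hasFDerivAt_const (J u) e)
    have h8 := h7.unique ((hasFDerivAt_const (D u) e).congr_of_eventuallyEq h3)
    simpa using congrArg (fun T : E →L[ℝ] F => T u) h8
  have q0 := hdiag ((ContinuousLinearMap.id ℝ E).prod (ContinuousLinearMap.id ℝ E)) 0 D₀ c₀
    (by simp) (by simpa using h₀) u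
  have q1 := hdiag (ContinuousLinearMap.inl ℝ E E) (0, e) D₁ c₁ (by simp) (by simpa using h₁) u
  have q2 := hdiag (ContinuousLinearMap.inr ℝ E E) (e, 0) D₂ c₂ (by simp) (by simpa using h₂) u
  have hfd : HasFDerivAt (fun y => fderiv ℝ (fun z => f (y, z)) e)
      (((ContinuousLinearMap.compL ℝ E (E × E) F).flip (ContinuousLinearMap.inr ℝ E E)).comp
        (Q.comp (ContinuousLinearMap.inl ℝ E E))) e := by
    have h3 : HasFDerivAt (fun y : E => fderiv ℝ f (y, e)) (Q.comp (ContinuousLinearMap.inl ℝ E E))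
        e :=
      HasFDerivAt.comp (f := fun y : E => (y, e)) e hQ (hasFDerivAt_prodMk_left e e)
    have h4 := (((ContinuousLinearMap.compL ℝ E (E × E) F).flip
      (ContinuousLinearMap.inr ℝ E E)).hasFDerivAt).comp e h3
    exact h4.congr_of_eventuallyEq ((eventually_hasFDerivAt_snd hf).mono fun y hy => hy.fderiv)
  rw [hfd.fderiv]
  have key : Q (u, 0) (0, u) = 0 := by
    have e1 : ((u, u) : E × E) = (u, 0) + (0, u) := by simp
    simp only [ContinuousLinearMap.prod_apply, ContinuousLinearMap.id_apply,
      ContinuousLinearMap.inl_apply, ContinuousLinearMap.inr_apply] at q0 q1 q2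
    rw [e1, map_add Q, add_apply, map_add, map_add, q1, q2,
      hsymm (0, u) (u, 0), zero_add, add_zero, ← two_smul ℝ] at q0
    exact (smul_eq_zero.1 q0).resolve_left two_ne_zero
  simpa using key

end PartialDerivative

section LieGroupCharts

variable {E : Type*} [NormedAddCommGroup E] [NormedSpace ℝ E]
  {H : Type*} [TopologicalSpace H] (I : ModelWithCorners ℝ E H)
  {G : Type*} [TopologicalSpace G] [ChartedSpace H G] [Group G]
  [I.Boundaryless] [LieGroup I ∞ G]

omit [LieGroup I ∞ G] in
theorem eventually_idChart_right_inv :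
    ∀ᶠ z in 𝓝 (idCoord I G), idChart I G ((idChart I G).symm z) = z :=
  Filter.mem_of_superset (idChart_target_mem_nhds I (idCoord_mem_target I))
    fun _ hz => (idChart I G).right_inv hz

theorem eventually_translate_mem_source (a b : G) {y : E} (hy : y ∈ (idChart I G).target)
    (h : a * (idChart I G).symm y * b ∈ (idChart I G).source) :
    ∀ᶠ z in 𝓝 y, a * (idChart I G).symm z * b ∈ (idChart I G).source :=
  ((contMDiffAt_const (c := a)).mul (contMDiffAt_idChart_symm I hy) |>.mul
    (contMDiffAt_const (c := b))).continuousAt.eventually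
      ((isOpen_extChartAt_source (1 : G)).mem_nhds h)

omit [LieGroup I ∞ G] [I.Boundaryless] in
theorem conj_idChart_symm_idCoord (g : G) : g * (idChart I G).symm (idCoord I G) * g⁻¹ = 1 := by
  rw [idChart_symm_idCoord, mul_one, mul_inv_cancel]

theorem hasFDerivAt_chartAd (g : G) :
    HasFDerivAt (fun z => idChart I G (g * (idChart I G).symm z * g⁻¹)) (chartAd I g)
      (idCoord I G) :=
  ((contDiffAt_translate I g g⁻¹ (idCoord_mem_target I) (by
    rw [conj_idChart_symm_idCoord]; exact one_mem_idChart_source I)).differentiableAt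
      (by simp)).hasFDerivAt

theorem chartAd_one : chartAd I (1 : G) = ContinuousLinearMap.id ℝ E := by
  refine (hasFDerivAt_chartAd I (1 : G)).unique ((hasFDerivAt_id _).congr_of_eventuallyEq ?_)
  filter_upwards [eventually_idChart_right_inv I (G := G)] with z hz
  rw [one_mul, inv_one, mul_one, hz, id]

theorem chartAd_mul (a b : G) : chartAd I (a * b) = (chartAd I a).comp (chartAd I b) := by
  have hb := hasFDerivAt_chartAd I b
  have ha : HasFDerivAt (fun z => idChart I G (a * (idChart I G).symm z * a⁻¹)) (chartAd I a)
      (idChart I G (b * (idChart I G).symm (idCoord I G) * b⁻¹)) := by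
    rw [conj_idChart_symm_idCoord]; exact hasFDerivAt_chartAd I a
  refine (hasFDerivAt_chartAd I (a * b)).unique
    ((ha.comp (idCoord I G) hb).congr_of_eventuallyEq ?_)
  filter_upwards [eventually_translate_mem_source I b b⁻¹ (idCoord_mem_target I)
    (by rw [conj_idChart_symm_idCoord]; exact one_mem_idChart_source I)] with z hz
  rw [Function.comp, (idChart I G).left_inv hz, mul_inv_rev]
  simp only [mul_assoc]

theorem lieAd_eq_chartAd (g : G) (v : GroupLieAlgebra I G) :
    lieAd I g v = (chartAd I g : E →L[ℝ] E) v := by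
  have hmd : MDifferentiableAt I I (fun x : G => g * x * g⁻¹) (1 : G) :=
    ((contMDiffAt_const.mul contMDiffAt_id).mul contMDiffAt_const :
      ContMDiffAt I I ∞ _ _).mdifferentiableAt (by simp)
  have h1 : g * 1 * g⁻¹ = 1 := by group
  have h2 : (mfderiv I I (fun x : G => g * x * g⁻¹) (1 : G) : E →L[ℝ] E) = chartAd I g := by
    refine hmd.mfderiv.trans ?_
    simp only [writtenInExtChartAt, I.range_eq_univ, fderivWithin_univ, h1]
    rfl
  exact congrArg (fun T : E →L[ℝ] E => T v) h2

variable (G) in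
theorem contDiffAt_chartAd :
    ContDiffAt ℝ 1 (fun y => chartAd I ((idChart I G).symm y)) (idCoord I G) :=
  contDiffAt_fderiv_snd (contDiffAt_chartConj I)

variable (G) in
theorem contDiffAt_chartLeftField : ContDiffAt ℝ 1 (chartLeftField I G) (idCoord I G) :=
  contDiffAt_fderiv_snd (contDiffAt_chartMul I)

variable (G) in
/-- The derivative of the adjoint representation at the identity. -/
noncomputable def chartBracket : E →L[ℝ] E →L[ℝ] E :=
  fderiv ℝ (fun y => chartAd I ((idChart I G).symm y)) (idCoord I G)

variable (G) in
theorem chartBracket_self (u : E) : chartBracket I G u u = 0 := by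
  refine fderiv_fderiv_snd_self (contDiffAt_chartConj I (G := G))
    (D₀ := ContinuousLinearMap.id ℝ E) (D₁ := 0) (D₂ := ContinuousLinearMap.id ℝ E)
    (c₀ := 0) (c₁ := idCoord I G) (c₂ := 0) ?_ ?_ ?_ u
  · filter_upwards [eventually_idChart_right_inv I (G := G)] with z hz
    simpa [chartConj] using hz
  · refine Eventually.of_forall fun z => ?_
    rw [chartConj, idChart_symm_idCoord, mul_one, mul_inv_cancel]
    rw [zero_apply, zero_add]
  · filter_upwards [eventually_idChart_right_inv I (G := G)] with z hz
    rw [chartConj, idChart_symm_idCoord, one_mul, inv_one, mul_one, hz]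
    simp

variable {I}

namespace HasLeftVelocityAt

variable {γ γ' : ℝ → G} {u : E} {t : ℝ}

omit [I.Boundaryless] in
theorem const_mul (h : HasLeftVelocityAt I γ u t) (x : G) :
    HasLeftVelocityAt I (fun s => x * γ s) u t := by
  have : ContMDiffMul I ∞ G := inferInstance
  have : ContinuousMul G := continuousMul_of_contMDiffMul I ∞
  refine ⟨continuousAt_const.mul h.1, ?_⟩
  simpa [mul_assoc] using h.2

omit [I.Boundaryless] [LieGroup I ∞ G] in
theorem congr (h : HasLeftVelocityAt I γ u t) (hγ : γ' =ᶠ[𝓝 t] γ) :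
    HasLeftVelocityAt I γ' u t := by
  refine ⟨h.1.congr hγ.symm, h.2.congr_of_eventuallyEq ?_⟩
  filter_upwards [hγ] with s hs
  rw [hs, hγ.eq_of_nhds]

omit [I.Boundaryless] [LieGroup I ∞ G] in
theorem comp_sub_const {t₀ : ℝ} (h : HasLeftVelocityAt I γ u (t - t₀)) :
    HasLeftVelocityAt I (fun s => γ (s - t₀)) u t :=
  ⟨ContinuousAt.comp (f := fun s => s - t₀) h.1 (by fun_prop), h.2.comp_sub_const t t₀⟩

omit [I.Boundaryless] [LieGroup I ∞ G] in
theorem comp_neg (h : HasLeftVelocityAt I γ u (-t)) :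
    HasLeftVelocityAt I (fun s => γ (-s)) (-u) t :=
  ⟨ContinuousAt.comp (f := fun s : ℝ => -s) h.1 (by fun_prop), by
    simpa [Function.comp_def] using
      HasDerivAt.scomp (g₁ := fun s => idChart I G ((γ (-t))⁻¹ * γ s)) t h.2 (hasDerivAt_neg t)⟩

theorem of_chart {c : ℝ → E} (hc : HasDerivAt c (chartLeftField I G (c t) u) t)
    (ht : c t ∈ (idChart I G).target) :
    HasLeftVelocityAt I (fun s => (idChart I G).symm (c s)) u t := by
  refine ⟨ContinuousAt.comp (f := c) (contMDiffAt_idChart_symm I ht).continuousAt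
    hc.continuousAt, ?_⟩
  set b := (idChart I G).symm (c t) with hb
  have hbs : b ∈ (idChart I G).source := (idChart I G).map_target ht
  have e1 : b⁻¹ * (idChart I G).symm (c t) * 1 = 1 := by rw [← hb]; group
  have e2 : b * (idChart I G).symm (idCoord I G) * 1 = b := by
    rw [idChart_symm_idCoord]; group
  have h1 := (contDiffAt_translate I b⁻¹ 1 ht
    (by rw [e1]; exact one_mem_idChart_source I)).differentiableAt (by simp) |>.hasFDerivAt
  have h2 := (contDiffAt_translate I b 1 (idCoord_mem_target I)
    (by rw [e2]; exact hbs)).differentiableAt (by simp) |>.hasFDerivAt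
  have h2ev := eventually_translate_mem_source I b 1 (idCoord_mem_target I) (by rw [e2]; exact hbs)
  simp only [mul_one] at h1 h2 h2ev e2
  set D₁ := fderiv ℝ (fun z => idChart I G (b⁻¹ * (idChart I G).symm z)) (c t)
  have hcomp : HasFDerivAt (fun z => idChart I G (b⁻¹ * (idChart I G).symm
      (idChart I G (b * (idChart I G).symm z)))) (D₁.comp (chartLeftField I G (c t)))
      (idCoord I G) := by
    refine HasFDerivAt.comp (g := fun z => idChart I G (b⁻¹ * (idChart I G).symm z))
      (f := fun z => idChart I G (b * (idChart I G).symm z)) _ ?_ h2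
    rw [e2, hb, (idChart I G).right_inv ht]
    exact h1
  have hid : D₁.comp (chartLeftField I G (c t)) = ContinuousLinearMap.id ℝ E := by
    refine hcomp.unique ((hasFDerivAt_id _).congr_of_eventuallyEq ?_)
    filter_upwards [eventually_idChart_right_inv I (G := G), h2ev] with z hz hz'
    rw [(idChart I G).left_inv hz', inv_mul_cancel_left, hz, id]
  have h3 := h1.comp_hasDerivAt t hc
  have h4 : D₁ (chartLeftField I G (c t) u) = u := congrArg (fun T : E →L[ℝ] E => T u) hid
  rwa [h4] at h3

omit [I.Boundaryless] in
theorem eventually_eq (h : HasLeftVelocityAt I γ u t) :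
    ∀ᶠ s in 𝓝 t, γ s = γ t * (idChart I G).symm (idChart I G ((γ t)⁻¹ * γ s)) := by
  have : ContMDiffMul I ∞ G := inferInstance
  have : ContinuousMul G := continuousMul_of_contMDiffMul I ∞
  have h1 : ContinuousAt (fun s => (γ t)⁻¹ * γ s) t := continuousAt_const.mul h.1
  have h2 : (idChart I G).source ∈ 𝓝 ((γ t)⁻¹ * γ t) := by
    rw [inv_mul_cancel]; exact extChartAt_source_mem_nhds 1
  filter_upwards [h1.eventually h2] with s hs
  rw [(idChart I G).left_inv hs, mul_inv_cancel_left]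

theorem hasDerivAt_chartAd (h : HasLeftVelocityAt I γ u t) :
    HasDerivAt (fun s => chartAd I (γ s)) ((chartAd I (γ t)).comp (chartBracket I G u)) t := by
  have h1 : HasFDerivAt (fun y => chartAd I ((idChart I G).symm y)) (chartBracket I G)
      (idChart I G ((γ t)⁻¹ * γ t)) := by
    rw [inv_mul_cancel]
    exact ((contDiffAt_chartAd I G).differentiableAt (by simp)).hasFDerivAt
  have h2 := h1.comp_hasDerivAt t h.2
  have h3 := (ContinuousLinearMap.compL ℝ E E E (chartAd I (γ t))).hasFDerivAt.comp_hasDerivAt t h2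
  refine h3.congr_of_eventuallyEq ?_
  filter_upwards [h.eventually_eq] with s hs
  rw [hs, chartAd_mul]
  simp

theorem hasMFDerivAt (h : HasLeftVelocityAt I γ u t) :
    HasMFDerivAt 𝓘(ℝ, ℝ) I γ t ((1 : ℝ →L[ℝ] ℝ).smulRight
      (mulInvariantVectorField (u : GroupLieAlgebra I G) (γ t))) := by
  have hI1 : IsManifold I 1 G := inferInstance
  have h1 : HasMFDerivAt 𝓘(ℝ, ℝ) 𝓘(ℝ, E) (fun s => idChart I G ((γ t)⁻¹ * γ s)) t
      ((1 : ℝ →L[ℝ] ℝ).smulRight u) := h.2.hasFDerivAt.hasMFDerivAt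
  have e1 : idChart I G ((γ t)⁻¹ * γ t) = idCoord I G := by rw [inv_mul_cancel]
  have h2 : HasMFDerivAt 𝓘(ℝ, E) I (idChart I G).symm (idChart I G ((γ t)⁻¹ * γ t))
      (ContinuousLinearMap.id ℝ E) := by
    rw [e1]
    have h3 := (mdifferentiableWithinAt_extChartAt_symm (I := I)
      (idCoord_mem_target I (G := G))).hasMFDerivWithinAt
    have h4 := mfderivWithin_range_extChartAt_symm (I := I) (x := (1 : G))
    rw [h4, I.range_eq_univ] at h3
    exact hasMFDerivWithinAt_univ.1 h3
  have h5 : HasMFDerivAt I I (fun x => γ t * x)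
      ((idChart I G).symm (idChart I G ((γ t)⁻¹ * γ t))) (mfderiv I I (fun x => γ t * x) 1) := by
    rw [e1, idChart_symm_idCoord]
    exact ((contMDiff_mul_left (I := I) (n := ∞) (a := γ t)).contMDiffAt.mdifferentiableAt
      (by simp)).hasMFDerivAt
  have h6 := (HasMFDerivAt.comp (f := fun s => (idChart I G).symm (idChart I G ((γ t)⁻¹ * γ s))) t
    h5 (h2.comp t h1)).congr_of_eventuallyEq h.eventually_eq
  refine h6.congr_mfderiv (ContinuousLinearMap.ext_ring ?_)
  have key (D : E →L[ℝ] E) : D ((1 : ℝ) • u) = (1 : ℝ) • D u := D.map_smul 1 u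
  exact key (mfderiv I I (fun x => γ t * x) 1)

end HasLeftVelocityAt

end LieGroupCharts

section SupportFunction

open scoped NNReal

variable {V : Type*} [NormedAddCommGroup V] [NormedSpace ℝ V]

/-- The support function of `K`: the supremum of a linear functional over `K`. -/
noncomputable def supportFunction (K : Set V) (h : V →L[ℝ] ℝ) : ℝ := sSup (h '' K)

variable {K : Set V}

theorem le_supportFunction (hK : IsCompact K) (h : V →L[ℝ] ℝ) {q : V} (hq : q ∈ K) :
    h q ≤ supportFunction K h :=
  le_csSup (hK.image h.continuous).bddAbove (mem_image_of_mem h hq)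

theorem supportFunction_eq_of_forall_le (hK : IsCompact K) {h : V →L[ℝ] ℝ} {p : V} (hp : p ∈ K)
    (hmax : ∀ q ∈ K, h q ≤ h p) : h p = supportFunction K h :=
  le_antisymm (le_supportFunction hK h hp)
    (csSup_le ⟨_, mem_image_of_mem h hp⟩ (forall_mem_image.2 hmax))

theorem lipschitzWith_supportFunction (hK : IsCompact K) (hKn : K.Nonempty) {R : ℝ≥0}
    (hR : ∀ p ∈ K, ‖p‖ ≤ R) : LipschitzWith R (supportFunction K) := by
  have key : ∀ h h' : V →L[ℝ] ℝ, supportFunction K h ≤ supportFunction K h' + R * dist h h' := by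
    intro h h'
    refine csSup_le (hKn.image h) (forall_mem_image.2 fun q hq => ?_)
    have h1 := le_supportFunction hK h' hq
    have h2 : (h - h') q ≤ ‖h - h'‖ * R :=
      (le_abs_self _).trans ((h - h').le_of_opNorm_le_of_le le_rfl (hR q hq))
    rw [sub_apply] at h2
    rw [dist_eq_norm, mul_comm]
    linarith
  exact LipschitzWith.of_le_add_mul R key

end SupportFunction

section LocalExtremal

open scoped NNReal

variable {E : Type*} [NormedAddCommGroup E] [NormedSpace ℝ E] [FiniteDimensional ℝ E]
  {H : Type*} [TopologicalSpace H] (I : ModelWithCorners ℝ E H)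
  (G : Type*) [TopologicalSpace G] [ChartedSpace H G] [Group G]
  [I.Boundaryless] [LieGroup I ∞ G]
  {V : Type*} [NormedAddCommGroup V] [NormedSpace ℝ V]

variable {G} in
/-- The functional `Λ ∘ Ad g`, restricted along `ι`. -/
noncomputable def restrictedCoad (ι : V →L[ℝ] E) (Λ : E →L[ℝ] ℝ) (g : G) : V →L[ℝ] ℝ :=
  (Λ.comp (chartAd I g)).comp ι

variable {I G} in
omit [FiniteDimensional ℝ E] in
theorem HasLeftVelocityAt.hasDerivAt_restrictedCoad {ι : V →L[ℝ] E} {Λ : E →L[ℝ] ℝ} {γ : ℝ → G}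
    {r : ℝ} {p : V} {t : ℝ} (h : HasLeftVelocityAt I γ (ι (r • p)) t) :
    HasDerivAt (fun s => restrictedCoad I ι Λ (γ s) p) 0 t := by
  have h1 := (h.hasDerivAt_chartAd).clm_apply (hasDerivAt_const t (ι p))
  have h2 := Λ.hasFDerivAt.comp_hasDerivAt t h1
  simpa [chartBracket_self, restrictedCoad, Function.comp_def] using h2

variable [FiniteDimensional ℝ V]

/-- Local existence of extremals from the identity, in the chart at the identity, with a life time
which does not depend on the covector. The support function of `K` is constant along them. -/
theorem exists_local_extremal {K : Set V} (hKc : IsCompact K) (hKn : K.Nonempty)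
    (hKconv : Convex ℝ K) (ι : V →L[ℝ] E) (r : ℝ) :
    ∃ δ > 0, ∀ Λ : E →L[ℝ] ℝ, ∃ (y : ℝ → E) (p : ℝ → V) (C : ℝ≥0),
      LipschitzWith C y ∧ y 0 = idCoord I G ∧ (∀ t ∈ Icc 0 δ, y t ∈ (idChart I G).target) ∧
      StronglyMeasurable p ∧
      (∀ t ∈ Icc 0 δ, supportFunction K (restrictedCoad I ι Λ ((idChart I G).symm (y t))) =
        supportFunction K (Λ.comp ι)) ∧
      ∀ᵐ t : ℝ, t ∈ Icc 0 δ → p t ∈ K ∧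
        HasLeftVelocityAt I (fun s => (idChart I G).symm (y s)) (ι (r • p t)) t ∧
        restrictedCoad I ι Λ ((idChart I G).symm (y t)) (p t) = supportFunction K (Λ.comp ι) := by
  obtain ⟨C₁, s₁, hs₁, hL₁⟩ := (contDiffAt_chartLeftField I G).exists_lipschitzOnWith
  obtain ⟨C₂, s₂, hs₂, hL₂⟩ := (contDiffAt_chartAd I G).exists_lipschitzOnWith
  obtain ⟨ρ, hρ, hsub⟩ := Metric.nhds_basis_closedBall.mem_iff.1
    (inter_mem (inter_mem hs₁ hs₂) (idChart_target_mem_nhds I (idCoord_mem_target I (G := G))))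
  have hA : ContinuousOn (fun y => (chartLeftField I G y).comp (r • ι))
      (Metric.closedBall (idCoord I G) ρ) :=
    (hL₁.continuousOn.mono fun y hy => (hsub hy).1.1).clm_comp continuousOn_const
  obtain ⟨δ, hδ, hex⟩ := exists_maximizing_control hKc hKn hKconv hρ hA
  refine ⟨δ, hδ, fun Λ => ?_⟩
  have hAd : LipschitzOnWith C₂ (fun y => chartAd I ((idChart I G).symm y))
      (Metric.closedBall (idCoord I G) ρ) := hL₂.mono fun y hy => (hsub hy).1.2
  let T : (E →L[ℝ] E) →L[ℝ] (V →L[ℝ] ℝ) :=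
    ((ContinuousLinearMap.compL ℝ V E ℝ).flip ι).comp (ContinuousLinearMap.compL ℝ E E ℝ Λ)
  have hℓ : LipschitzOnWith (‖T‖₊ * C₂)
      (fun y => restrictedCoad I ι Λ ((idChart I G).symm y))
      (Metric.closedBall (idCoord I G) ρ) := T.lipschitz.comp_lipschitzOnWith hAd
  obtain ⟨y, p, C, hyL, hy0, hyball, hp, hae⟩ := hex _ hℓ.continuousOn
  have htarget : ∀ t ∈ Icc 0 δ, y t ∈ (idChart I G).target := fun t ht => (hsub (hyball t ht)).2
  have hvel : ∀ᵐ t : ℝ, t ∈ Icc 0 δ → p t ∈ K ∧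
        HasLeftVelocityAt I (fun s => (idChart I G).symm (y s)) (ι (r • p t)) t ∧
        restrictedCoad I ι Λ ((idChart I G).symm (y t)) (p t) =
          supportFunction K (restrictedCoad I ι Λ ((idChart I G).symm (y t))) := by
    filter_upwards [hae] with t h ht
    obtain ⟨h1, h2, h3⟩ := h ht
    refine ⟨h1, .of_chart ?_ (htarget t ht), supportFunction_eq_of_forall_le hKc h1 h3⟩
    simpa using h2
  obtain ⟨R, hR⟩ := hKc.exists_bound_of_continuousOn continuousOn_id
  have hN := lipschitzWith_supportFunction hKc hKn (R := R.toNNReal)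
    fun q hq => (hR q hq).trans (Real.le_coe_toNNReal _)
  have hδ' : uIcc 0 δ = Icc 0 δ := uIcc_of_le hδ.le
  have hac : AbsolutelyContinuousOnInterval
      (fun t => supportFunction K (restrictedCoad I ι Λ ((idChart I G).symm (y t)))) 0 δ := by
    refine LipschitzOnWith.absolutelyContinuousOnInterval (K := R.toNNReal * (‖T‖₊ * C₂ * C)) ?_
    rw [hδ']
    exact hN.comp_lipschitzOnWith (hℓ.comp hyL.lipschitzOnWith hyball)
  obtain ⟨c, hc⟩ := hac.const_of_ae_hasDerivAt_zero (by
    filter_upwards [hvel, hac.ae_differentiableAt] with t ht hdiff htI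
    obtain ⟨h1, h2, h3⟩ := ht (hδ' ▸ htI)
    have h4 := (hdiff htI).hasDerivAt
    have h5 := h4.sub (h2.hasDerivAt_restrictedCoad (Λ := Λ))
    have hmin : IsLocalMin (fun s =>
        supportFunction K (restrictedCoad I ι Λ ((idChart I G).symm (y s))) -
          restrictedCoad I ι Λ ((idChart I G).symm (y s)) (p t)) t :=
      Eventually.of_forall fun s => by
        simp only [h3, sub_self]
        exact sub_nonneg.2 (le_supportFunction hKc _ h1)
    have h6 := hmin.hasDerivAt_eq_zero h5
    rw [sub_zero] at h6
    rwa [h6] at h4)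
  rw [hδ'] at hc
  have hconst : ∀ t ∈ Icc 0 δ, supportFunction K (restrictedCoad I ι Λ ((idChart I G).symm (y t))) =
      supportFunction K (Λ.comp ι) := by
    intro t ht
    rw [hc t ht, ← hc 0 ⟨le_rfl, hδ.le⟩, hy0, idChart_symm_idCoord, restrictedCoad, chartAd_one,
      ContinuousLinearMap.comp_id]
  refine ⟨y, p, C, hyL, hy0, htarget, hp, hconst, ?_⟩
  filter_upwards [hvel] with t h ht
  obtain ⟨h1, h2, h3⟩ := h ht
  exact ⟨h1, h2, h3.trans (hconst t ht)⟩

end LocalExtremal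

section LipschitzInChart

open scoped NNReal

variable {E : Type*} [NormedAddCommGroup E] [NormedSpace ℝ E]
  {H : Type*} [TopologicalSpace H] (I : ModelWithCorners ℝ E H)
  {G : Type*} [TopologicalSpace G] [ChartedSpace H G]

/-- Near `t`, the curve `γ` stays in the preferred chart at `γ t` and is Lipschitz there. -/
def IsLipschitzInChartAt (γ : ℝ → G) (t : ℝ) : Prop :=
  ∃ C : ℝ≥0, ∃ N ∈ 𝓝 t, MapsTo γ N (chartAt H (γ t)).source ∧
    LipschitzOnWith C (fun s => extChartAt I (γ t) (γ s)) N

variable {I} {γ : ℝ → G}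

theorem LipschitzOnWith.Ioo_of_split {X : Type*} [PseudoMetricSpace X] {f : ℝ → X} {C : ℝ≥0}
    {a t b : ℝ} (h₁ : LipschitzOnWith C f (Ioc a t)) (h₂ : LipschitzOnWith C f (Ico t b)) :
    LipschitzOnWith C f (Ioo a b) := by
  have key : ∀ x ∈ Ioo a b, ∀ y ∈ Ioo a b, x ≤ y → dist (f x) (f y) ≤ C * dist x y := by
    intro x hx y hy hxy
    rcases le_total y t with hyt | hyt
    · exact h₁.dist_le_mul x ⟨hx.1, hxy.trans hyt⟩ y ⟨hy.1, hyt⟩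
    rcases le_total t x with hxt | hxt
    · exact h₂.dist_le_mul x ⟨hxt, hx.2⟩ y ⟨hyt, hy.2⟩
    have e1 := h₁.dist_le_mul x ⟨hx.1, hxt⟩ t ⟨hx.1.trans_le hxt, le_rfl⟩
    have e2 := h₂.dist_le_mul t ⟨le_rfl, hyt.trans_lt hy.2⟩ y ⟨hyt, hy.2⟩
    have e3 : dist x y = dist x t + dist t y := by
      rw [Real.dist_eq, Real.dist_eq, Real.dist_eq, abs_of_nonpos (sub_nonpos.2 hxy),
        abs_of_nonpos (sub_nonpos.2 hxt), abs_of_nonpos (sub_nonpos.2 hyt)]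
      ring
    rw [e3, mul_add]
    exact (dist_triangle _ (f t) _).trans (add_le_add e1 e2)
  refine LipschitzOnWith.of_dist_le_mul fun x hx y hy => ?_
  rcases le_total x y with h | h
  · exact key x hx y hy h
  · rw [dist_comm, dist_comm x]
    exact key y hy x hx h

theorem IsLipschitzInChartAt.of_left_right {t : ℝ} {c₁ c₂ : ℝ → G}
    (h₁ : IsLipschitzInChartAt I c₁ t) (h₂ : IsLipschitzInChartAt I c₂ t)
    (e₁ : γ =ᶠ[𝓝[≤] t] c₁) (e₂ : γ =ᶠ[𝓝[≥] t] c₂) : IsLipschitzInChartAt I γ t := by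
  obtain ⟨C₁, N₁, hN₁, hm₁, hL₁⟩ := h₁
  obtain ⟨C₂, N₂, hN₂, hm₂, hL₂⟩ := h₂
  have q₁ : γ t = c₁ t := e₁.eq_of_nhdsWithin self_mem_Iic
  have q₂ : γ t = c₂ t := e₂.eq_of_nhdsWithin self_mem_Ici
  rw [← q₁] at hm₁ hL₁
  rw [← q₂] at hm₂ hL₂
  obtain ⟨a, ha, hsub₁⟩ := (mem_nhdsLE_iff_exists_Ioc_subset' (sub_one_lt t)).1
    (inter_mem e₁ (mem_nhdsWithin_of_mem_nhds hN₁))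
  obtain ⟨b, hb, hsub₂⟩ := (mem_nhdsGE_iff_exists_Ico_subset' (lt_add_one t)).1
    (inter_mem e₂ (mem_nhdsWithin_of_mem_nhds hN₂))
  refine ⟨max C₁ C₂, Ioo a b, Ioo_mem_nhds ha hb, fun s hs => ?_, ?_⟩
  · rcases le_total s t with h | h
    · have := hsub₁ ⟨hs.1, h⟩
      rw [show γ s = c₁ s from this.1]
      exact hm₁ this.2
    · have := hsub₂ ⟨h, hs.2⟩
      rw [show γ s = c₂ s from this.1]
      exact hm₂ this.2
  · refine LipschitzOnWith.Ioo_of_split (t := t) ?_ ?_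
    · have h := (hL₁.weaken (le_max_left C₁ C₂)).mono fun s hs => (hsub₁ hs).2
      intro x hx y hy
      simpa only [show γ x = c₁ x from (hsub₁ hx).1, show γ y = c₁ y from (hsub₁ hy).1]
        using h hx hy
    · have h := (hL₂.weaken (le_max_right C₁ C₂)).mono fun s hs => (hsub₂ hs).2
      intro x hx y hy
      simpa only [show γ x = c₂ x from (hsub₂ hx).1, show γ y = c₂ y from (hsub₂ hy).1]
        using h hx hy

theorem IsLipschitzInChartAt.comp_neg {t : ℝ} (h : IsLipschitzInChartAt I γ (-t)) :
    IsLipschitzInChartAt I (fun s => γ (-s)) t := by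
  obtain ⟨C, N, hN, hm, hL⟩ := h
  refine ⟨C, Neg.neg ⁻¹' N, continuous_neg.continuousAt hN, fun s hs => hm hs, fun x hx y hy => ?_⟩
  simpa using hL (show -x ∈ N from hx) (show -y ∈ N from hy)

theorem isLocallyACOn_univ (h : ∀ t, IsLipschitzInChartAt I γ t) : IsLocallyACOn I γ univ := by
  intro t _
  obtain ⟨C, N, hN, hm, hL⟩ := h t
  obtain ⟨ε, hε, hsub⟩ := Metric.nhds_basis_closedBall.mem_iff.1 hN
  rw [Real.closedBall_eq_Icc] at hsub
  refine ⟨t - ε, t + ε, subset_univ _, mem_nhdsWithin_of_mem_nhds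
    (Icc_mem_nhds (by linarith) (by linarith)), hm.mono_left hsub, ?_⟩
  refine LipschitzOnWith.absolutelyContinuousOnInterval (hL.mono ?_)
  rwa [uIcc_of_le (by linarith)]

theorem LipschitzWith.isLipschitzInChartAt [Group G] [I.Boundaryless] [LieGroup I ∞ G] {y : ℝ → E}
    {C : ℝ≥0} (hy : LipschitzWith C y) {t : ℝ} (ht : y t ∈ (idChart I G).target) (x : G) :
    IsLipschitzInChartAt I (fun s => x * (idChart I G).symm (y s)) t := by
  have hI : IsManifold I ∞ G := inferInstance
  set b := x * (idChart I G).symm (y t) with hb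
  have h1 : ContMDiffAt 𝓘(ℝ, E) I ∞ (fun z => x * (idChart I G).symm z) (y t) :=
    contMDiffAt_const.mul (contMDiffAt_idChart_symm I ht)
  have h2 : ContDiffAt ℝ ∞ (fun z => extChartAt I b (x * (idChart I G).symm z)) (y t) :=
    ((contMDiffAt_extChartAt' (mem_chart_source H b)).comp (y t) h1).contDiffAt
  obtain ⟨C', N, hN, hL⟩ := (h2.of_le (by exact_mod_cast le_top)).exists_lipschitzOnWith
  have h3 : ∀ᶠ z in 𝓝 (y t), x * (idChart I G).symm z ∈ (chartAt H b).source :=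
    h1.continuousAt.eventually ((chartAt H b).open_source.mem_nhds (mem_chart_source H b))
  have hyc := hy.continuous.tendsto t
  exact ⟨C' * C, y ⁻¹' N ∩ {s | x * (idChart I G).symm (y s) ∈ (chartAt H b).source},
    inter_mem (hyc hN) (hyc.eventually h3), fun s hs => hs.2,
    hL.comp (hy.lipschitzOnWith (s := _)) fun s hs => hs.1⟩

end LipschitzInChart

section GlobalExtremal

open scoped NNReal

theorem ae_comp_sub_const {p : ℝ → Prop} (h : ∀ᵐ t, p t) (a : ℝ) : ∀ᵐ t, p (t - a) :=
  (measurePreserving_sub_right volume a).quasiMeasurePreserving.ae h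

theorem ae_comp_neg {p : ℝ → Prop} (h : ∀ᵐ t, p t) : ∀ᵐ t, p (-t) :=
  (Measure.measurePreserving_neg (volume : Measure ℝ)).quasiMeasurePreserving.ae h

theorem StronglyMeasurable.of_nat_indexed {V : Type*} [NormedAddCommGroup V]
    {F : ℕ → ℝ → V} (hF : ∀ k, StronglyMeasurable (F k)) {k : ℝ → ℕ} (hk : Measurable k) :
    StronglyMeasurable fun t => F (k t) t := by
  borelize V
  refine stronglyMeasurable_iff_measurable_separable.2 ⟨?_, ?_⟩
  · have : Measurable fun w : ℕ × ℝ => F w.1 w.2 :=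
      measurable_from_prod_countable_right fun j => (hF j).measurable
    exact this.comp (hk.prodMk measurable_id)
  · exact (TopologicalSpace.isSeparable_iUnion.2
      fun j => (hF j).isSeparable_range).mono
        (range_subset_iff.2 fun t => mem_iUnion.2 ⟨k t, t, rfl⟩)

variable {E : Type*} [NormedAddCommGroup E] [NormedSpace ℝ E] [FiniteDimensional ℝ E]
  {H : Type*} [TopologicalSpace H] (I : ModelWithCorners ℝ E H)
  {G : Type*} [TopologicalSpace G] [ChartedSpace H G] [Group G]
  [I.Boundaryless] [LieGroup I ∞ G]
  {V : Type*} [NormedAddCommGroup V] [NormedSpace ℝ V]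

omit [FiniteDimensional ℝ E] in
theorem restrictedCoad_mul (ι : V →L[ℝ] E) (Λ : E →L[ℝ] ℝ) (a b : G) :
    restrictedCoad I ι Λ (a * b) = restrictedCoad I ι (Λ.comp (chartAd I a)) b := by
  rw [restrictedCoad, chartAd_mul]
  rfl

variable [FiniteDimensional ℝ V]

/-- Existence of extremals on a half line. -/
theorem exists_extremal_ray {K : Set V} (hKc : IsCompact K) (hKn : K.Nonempty)
    (hKconv : Convex ℝ K) (ι : V →L[ℝ] E) (r : ℝ) (Λ : E →L[ℝ] ℝ) (g : G) :
    ∃ (γ : ℝ → G) (p : ℝ → V), γ 0 = g ∧ StronglyMeasurable p ∧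
      (∀ t, 0 ≤ t → ∃ c, IsLipschitzInChartAt I c t ∧ γ =ᶠ[𝓝[≥] t] c) ∧
      (∀ t, 0 < t → ∃ c, IsLipschitzInChartAt I c t ∧ γ =ᶠ[𝓝[≤] t] c) ∧
      ∀ᵐ t : ℝ, 0 < t → p t ∈ K ∧ HasLeftVelocityAt I γ (ι (r • p t)) t ∧
        restrictedCoad I ι Λ (γ t) (p t) = supportFunction K (restrictedCoad I ι Λ g) ∧
        supportFunction K (restrictedCoad I ι Λ (γ t)) =
          supportFunction K (restrictedCoad I ι Λ g) := by
  obtain ⟨δ, hδ, hloc⟩ := exists_local_extremal I G hKc hKn hKconv ι r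
  choose y p C hyL hy0 hyt hpm hconst hae using fun x : G => hloc (Λ.comp (chartAd I x))
  let node : ℕ → G := fun k => Nat.rec g (fun _ x => x * (idChart I G).symm (y x δ)) k
  have hnode : ∀ k, node (k + 1) = node k * (idChart I G).symm (y (node k) δ) := fun _ => rfl
  have hN : ∀ k, supportFunction K (restrictedCoad I ι Λ (node k)) =
      supportFunction K (restrictedCoad I ι Λ g) := by
    intro k
    induction k with
    | zero => rfl
    | succ k ih =>
      rw [hnode, restrictedCoad_mul, hconst _ δ ⟨hδ.le, le_rfl⟩]
      exact ih
  let piece : ℕ → ℝ → G := fun k t => node k * (idChart I G).symm (y (node k) (t - k * δ))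
  let idx : ℝ → ℕ := fun t => ⌊t / δ⌋₊
  let γ : ℝ → G := fun t => piece (idx t) t
  have hidx : ∀ (k : ℕ) (t : ℝ), t ∈ Ico (k * δ) ((k + 1) * δ) → idx t = k := by
    intro k t ht
    have h3 : (k : ℝ) ≤ t / δ := (le_div_iff₀ hδ).2 ht.1
    exact (Nat.floor_eq_iff (k.cast_nonneg.trans h3)).2 ⟨h3, (div_lt_iff₀ hδ).2 ht.2⟩
  have hidx' : ∀ t, 0 ≤ t → t ∈ Ico (idx t * δ) ((idx t + 1) * δ) := by
    intro t ht
    exact ⟨(le_div_iff₀ hδ).1 (Nat.floor_le (by positivity)),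
      (div_lt_iff₀ hδ).1 (Nat.lt_floor_add_one _)⟩
  have hstart : ∀ k : ℕ, piece k (k * δ) = node k := by
    intro k
    simp only [piece, sub_self, hy0, idChart_symm_idCoord, mul_one]
  have hpiece : ∀ (k : ℕ) (t : ℝ), t ∈ Icc (k * δ) ((k + 1) * δ) → γ t = piece k t := by
    intro k t ht
    rcases ht.2.lt_or_eq with h | h
    · simp only [γ, hidx k t ⟨ht.1, h⟩]
    · have h1 : idx t = k + 1 := hidx (k + 1) t
        ⟨by push_cast; exact h.ge, by push_cast; nlinarith⟩
      have h2 : t = (k + 1 : ℕ) * δ := by push_cast; exact h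
      have h3 : t - k * δ = δ := by rw [h]; ring
      calc γ t = piece (k + 1) t := by simp only [γ, h1]
        _ = node (k + 1) := by rw [h2]; exact hstart (k + 1)
        _ = piece k t := by rw [hnode]; simp only [piece, h3]
  have hlip : ∀ (k : ℕ) (t : ℝ), t ∈ Icc (k * δ) ((k + 1) * δ) →
      IsLipschitzInChartAt I (piece k) t := by
    intro k t ht
    have h1 : LipschitzWith (C (node k)) fun s => y (node k) (s - k * δ) := by
      simpa [Function.comp_def] using
        (hyL (node k)).comp (LipschitzWith.of_dist_le_mul (K := 1) (f := fun s : ℝ => s - k * δ)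
          fun a b => by simp)
    exact h1.isLipschitzInChartAt
      (hyt _ _ ⟨by linarith [ht.1], by linarith [ht.2]⟩) (node k)
  refine ⟨γ, fun t => p (node (idx t)) (t - idx t * δ), ?_, ?_, ?_, ?_, ?_⟩
  · rw [hpiece 0 0 (by simp [hδ.le])]
    refine Eq.trans ?_ (rfl : node 0 = g)
    simpa using hstart 0
  · refine StronglyMeasurable.of_nat_indexed (F := fun k t => p (node k) (t - k * δ)) (fun k => ?_)
      (Nat.measurable_floor.comp (measurable_id.div_const δ))
    exact (hpm _).comp_measurable (measurable_id.sub_const _)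
  · intro t ht
    have h := hidx' t ht
    refine ⟨piece (idx t), hlip _ t ⟨h.1, h.2.le⟩, ?_⟩
    filter_upwards [Ico_mem_nhdsGE h.2] with s hs
    exact hpiece _ s ⟨h.1.trans hs.1, hs.2.le⟩
  · intro t ht
    obtain ⟨k, hk⟩ : ∃ k : ℕ, t ∈ Ioc (k * δ) ((k + 1) * δ) := by
      have h := hidx' t ht.le
      rcases h.1.lt_or_eq with h1 | h1
      · exact ⟨idx t, h1, h.2.le⟩
      · have h2 : idx t ≠ 0 := by
          intro h2
          rw [h2] at h1
          simp at h1
          exact ht.ne h1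
        obtain ⟨k, hk⟩ := Nat.exists_eq_succ_of_ne_zero h2
        refine ⟨k, ?_⟩
        rw [hk] at h1
        push_cast at h1
        exact ⟨by nlinarith, h1.ge⟩
    refine ⟨piece k, hlip _ t ⟨hk.1.le, hk.2⟩, ?_⟩
    filter_upwards [Ioc_mem_nhdsLE hk.1] with s hs
    exact hpiece _ s ⟨hs.1.le, hs.2.trans hk.2⟩
  · have h1 : ∀ᵐ t : ℝ, t ∉ range fun k : ℕ => (k : ℝ) * δ :=
      (countable_range _).ae_notMem _
    have h2 := ae_all_iff.2 fun k : ℕ => ae_comp_sub_const (hae (node k)) (k * δ)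
    filter_upwards [h1, h2] with t ht1 ht2 ht0
    have h := hidx' t ht0.le
    set k := idx t with hk
    have hlt : k * δ < t := lt_of_le_of_ne h.1 fun h => ht1 ⟨k, h⟩
    have hI : t - k * δ ∈ Icc 0 δ := ⟨by linarith, by linarith [h.2]⟩
    obtain ⟨a1, a2, a3⟩ := ht2 k hI
    have hγ : γ t = node k * (idChart I G).symm (y (node k) (t - k * δ)) :=
      hpiece k t ⟨h.1, h.2.le⟩
    refine ⟨a1, ?_, ?_, ?_⟩
    · refine (a2.comp_sub_const.const_mul (node k)).congr ?_
      filter_upwards [Ioo_mem_nhds hlt h.2] with s hs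
      exact hpiece k s ⟨hs.1.le, hs.2.le⟩
    · rw [hγ, restrictedCoad_mul, a3]
      exact hN k
    · rw [hγ, restrictedCoad_mul, hconst _ _ hI]
      exact hN k

/-- Existence of extremals on the whole line. -/
theorem exists_extremal_line {K : Set V} (hKc : IsCompact K) (hKn : K.Nonempty)
    (hKconv : Convex ℝ K) (ι : V →L[ℝ] E) (r : ℝ) (Λ : E →L[ℝ] ℝ) (g : G) :
    ∃ (γ : ℝ → G) (p : ℝ → V), γ 0 = g ∧ StronglyMeasurable p ∧
      (∀ t, IsLipschitzInChartAt I γ t) ∧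
      ∀ᵐ t : ℝ, p t ∈ K ∧ HasLeftVelocityAt I γ (ι (r • p t)) t ∧
        restrictedCoad I ι Λ (γ t) (p t) = supportFunction K (restrictedCoad I ι Λ g) ∧
        supportFunction K (restrictedCoad I ι Λ (γ t)) =
          supportFunction K (restrictedCoad I ι Λ g) := by
  obtain ⟨γ₁, p₁, h₁0, hp₁, hR₁, hL₁, hae₁⟩ := exists_extremal_ray I hKc hKn hKconv ι r Λ g
  obtain ⟨γ₂, p₂, h₂0, hp₂, hR₂, hL₂, hae₂⟩ := exists_extremal_ray I hKc hKn hKconv ι (-r) Λ g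
  let γ : ℝ → G := fun t => if 0 ≤ t then γ₁ t else γ₂ (-t)
  have hpos : ∀ t, 0 ≤ t → γ t = γ₁ t := fun t ht => if_pos ht
  have hneg : ∀ t, t ≤ 0 → γ t = γ₂ (-t) := by
    intro t ht
    rcases ht.lt_or_eq with h | rfl
    · exact if_neg h.not_ge
    · rw [hpos 0 le_rfl, h₁0, neg_zero, h₂0]
  have hright : ∀ t, ∃ c, IsLipschitzInChartAt I c t ∧ γ =ᶠ[𝓝[≥] t] c := by
    intro t
    rcases le_or_gt 0 t with ht | ht
    · obtain ⟨c, hc, he⟩ := hR₁ t ht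
      refine ⟨c, hc, ?_⟩
      filter_upwards [he, self_mem_nhdsWithin] with s hs hts
      rw [hpos s (ht.trans hts), hs]
    · obtain ⟨c, hc, he⟩ := hL₂ (-t) (neg_pos.2 ht)
      refine ⟨_, hc.comp_neg, ?_⟩
      have htend : Tendsto (fun s : ℝ => -s) (𝓝[≥] t) (𝓝[≤] (-t)) := tendsto_neg_nhdsGE
      filter_upwards [htend.eventually he, mem_nhdsWithin_of_mem_nhds (Iio_mem_nhds ht)]
        with s hs hts
      rw [hneg s (le_of_lt hts), hs]
  have hleft : ∀ t, ∃ c, IsLipschitzInChartAt I c t ∧ γ =ᶠ[𝓝[≤] t] c := by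
    intro t
    rcases lt_or_ge 0 t with ht | ht
    · obtain ⟨c, hc, he⟩ := hL₁ t ht
      refine ⟨c, hc, ?_⟩
      filter_upwards [he, mem_nhdsWithin_of_mem_nhds (Ioi_mem_nhds ht)] with s hs hts
      rw [hpos s (le_of_lt hts), hs]
    · obtain ⟨c, hc, he⟩ := hR₂ (-t) (neg_nonneg.2 ht)
      refine ⟨_, hc.comp_neg, ?_⟩
      have htend : Tendsto (fun s : ℝ => -s) (𝓝[≤] t) (𝓝[≥] (-t)) := tendsto_neg_nhdsLE
      filter_upwards [htend.eventually he, self_mem_nhdsWithin] with s hs hts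
      rw [hneg s (le_trans hts ht), hs]
  refine ⟨γ, fun t => if 0 ≤ t then p₁ t else p₂ (-t), (hpos 0 le_rfl).trans h₁0, ?_, ?_, ?_⟩
  · exact StronglyMeasurable.ite measurableSet_Ici hp₁ (hp₂.comp_measurable measurable_neg)
  · intro t
    obtain ⟨c₁, hc₁, he₁⟩ := hleft t
    obtain ⟨c₂, hc₂, he₂⟩ := hright t
    exact hc₁.of_left_right hc₂ he₁ he₂
  · filter_upwards [hae₁, ae_comp_neg hae₂, (countable_singleton (0 : ℝ)).ae_notMem _]
      with t ht₁ ht₂ ht0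
    rcases lt_or_gt_of_ne ht0 with h | h
    · obtain ⟨a1, a2, a3⟩ := ht₂ (neg_pos.2 h)
      rw [if_neg h.not_ge, hneg t h.le]
      refine ⟨a1, ?_, a3⟩
      have h1 := a2.comp_neg
      rw [neg_smul, map_neg, neg_neg] at h1
      refine h1.congr ?_
      filter_upwards [Iio_mem_nhds h] with s hs using hneg s (le_of_lt hs)
    · obtain ⟨a1, a2, a3⟩ := ht₁ h
      rw [if_pos h.le, hpos t h.le]
      refine ⟨a1, a2.congr ?_, a3⟩
      filter_upwards [Ioi_mem_nhds h] with s hs using hpos s (le_of_lt hs)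

end GlobalExtremal

section NormalCurves

variable {V : Type*} [NormedAddCommGroup V] [NormedSpace ℝ V] [FiniteDimensional ℝ V]

theorem Seminorm.continuous_of_finiteDimensional_real (N : Seminorm ℝ V) : Continuous N :=
  continuousOn_univ.1 (N.convexOn.continuousOn isOpen_univ)

theorem Seminorm.isCompact_unitBall (N : Seminorm ℝ V) (hN : ∀ v, N v = 0 → v = 0) :
    IsCompact {v | N v ≤ 1} := by
  have hc := N.continuous_of_finiteDimensional_real
  obtain ⟨c, hc0, hle⟩ : ∃ c > 0, ∀ v, c * ‖v‖ ≤ N v := by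
    rcases subsingleton_or_nontrivial V with h | h
    · exact ⟨1, one_pos, fun v => by simp [Subsingleton.elim v 0]⟩
    obtain ⟨w, hw, hmin⟩ := (isCompact_sphere (0 : V) 1).exists_isMinOn
      (NormedSpace.sphere_nonempty.2 zero_le_one) hc.continuousOn
    have hw0 : w ≠ 0 := ne_zero_of_mem_unit_sphere ⟨w, hw⟩
    refine ⟨N w, lt_of_le_of_ne (apply_nonneg N w) fun h => hw0 (hN w h.symm), fun v => ?_⟩
    rcases eq_or_ne v 0 with rfl | hv
    · simp
    have hv' : 0 < ‖v‖ := norm_pos_iff.2 hv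
    have h1 : N w ≤ N (‖v‖⁻¹ • v) := hmin (by simp [norm_smul, hv'.ne'])
    rw [map_smul_eq_mul, norm_inv, norm_norm, inv_mul_eq_div, le_div_iff₀ hv'] at h1
    exact h1
  refine (isCompact_closedBall (0 : V) c⁻¹).of_isClosed_subset
    (isClosed_le hc continuous_const) fun v hv => ?_
  rw [mem_closedBall_zero_iff, ← one_div, le_div_iff₀ hc0, mul_comm]
  exact (hle v).trans hv

/-- If `p` maximizes `h` over the unit ball of `N`, with maximum `r`, then `h` is a subgradient of
`N ^ 2 / 2` at `r • p`. -/
theorem mem_subdifferential_sq_of_eq_supportFunction {N : Seminorm ℝ V}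
    (hN : ∀ v, N v = 0 → v = 0) {h : V →L[ℝ] ℝ} {p : V} {r : ℝ} (hp : N p ≤ 1) (hr : 0 ≤ r)
    (hhp : h p = r) (hsup : supportFunction {v | N v ≤ 1} h = r) :
    (h : Module.Dual ℝ V) ∈ subdifferential (fun v => N v ^ 2 / 2) (r • p) := by
  intro v
  have hle : h v ≤ r * N v := by
    rcases eq_or_ne v 0 with rfl | hv
    · simp
    have hv' : 0 < N v := lt_of_le_of_ne (apply_nonneg N v) fun h => hv (hN v h.symm)
    have h1 := le_supportFunction (N.isCompact_unitBall hN) h (q := (N v)⁻¹ • v) (by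
      simp [map_smul_eq_mul, abs_of_pos hv', hv'.ne'])
    rw [hsup, map_smul, smul_eq_mul, inv_mul_eq_div, div_le_iff₀ hv'] at h1
    exact h1
  have h2 : N (r • p) ≤ r := by
    rw [map_smul_eq_mul, Real.norm_eq_abs, abs_of_nonneg hr]
    nlinarith
  have h3 : h (v - r • p) = h v - r * r := by rw [map_sub, map_smul, hhp, smul_eq_mul]
  have h4 := apply_nonneg N (r • p)
  change h (v - r • p) ≤ N v ^ 2 / 2 - N (r • p) ^ 2 / 2
  rw [h3]
  nlinarith [sq_nonneg (N v - r)]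

variable {E : Type*} [NormedAddCommGroup E] [NormedSpace ℝ E] [FiniteDimensional ℝ E]
  {H : Type*} [TopologicalSpace H] (I : ModelWithCorners ℝ E H)
  {G : Type*} [TopologicalSpace G] [ChartedSpace H G] [Group G]
  [I.Boundaryless] [LieGroup I ∞ G]

theorem exists_normal_extremal {N : Seminorm ℝ V} (hN : ∀ v, N v = 0 → v = 0) (ι : V →L[ℝ] E)
    (Λ : E →L[ℝ] ℝ) (g : G) :
    ∃ (γ : ℝ → G) (u : ℝ → V) (r : ℝ), γ 0 = g ∧ StronglyMeasurable u ∧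
      (∀ t, IsLipschitzInChartAt I γ t) ∧
      ∀ᵐ t : ℝ, N (u t) ≤ r ∧ HasLeftVelocityAt I γ (ι (u t)) t ∧
        (restrictedCoad I ι Λ (γ t) : Module.Dual ℝ V) ∈
          subdifferential (fun v => N v ^ 2 / 2) (u t) := by
  have hK := N.isCompact_unitBall hN
  have h0 : (0 : V) ∈ {v | N v ≤ 1} := by simp
  have hconv : Convex ℝ {v | N v ≤ 1} := by
    simpa using N.convexOn.convex_le 1
  set r := supportFunction {v | N v ≤ 1} (restrictedCoad I ι Λ g) with hr
  have hr0 : 0 ≤ r := by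
    simpa using le_supportFunction hK (restrictedCoad I ι Λ g) h0
  obtain ⟨γ, p, hγ0, hp, hlip, hae⟩ := exists_extremal_line I hK ⟨0, h0⟩ hconv ι r Λ g
  refine ⟨γ, fun t => r • p t, r, hγ0, hp.const_smul r, hlip, ?_⟩
  filter_upwards [hae] with t ⟨h1, h2, h3, h4⟩
  refine ⟨?_, h2, mem_subdifferential_sq_of_eq_supportFunction hN h1 hr0 h3 h4⟩
  rw [map_smul_eq_mul, Real.norm_eq_abs, abs_of_nonneg hr0]
  have h5 : N (p t) ≤ 1 := h1
  nlinarith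

end NormalCurves

theorem mainTheorem9
    {E : Type*} [NormedAddCommGroup E] [NormedSpace ℝ E] [FiniteDimensional ℝ E]
    [CompleteSpace E]
    {H : Type*} [TopologicalSpace H] (I : ModelWithCorners ℝ E H) [I.Boundaryless]
    {G : Type*} [TopologicalSpace G] [T2Space G] [ChartedSpace H G] [Group G]
    [LieGroup I ∞ G]
    (S : SubFinslerStructure I G)
    (lam : Module.Dual ℝ (GroupLieAlgebra I G)) (g : G) :
    ∃ γ : ℝ → G, γ 0 = g ∧ S.IsNormalCurveWithCovector γ univ lam := by
  let W : Submodule ℝ E := S.polarization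
  let N : Seminorm ℝ W := S.norm
  let Λ : E →L[ℝ] ℝ := LinearMap.toContinuousLinearMap (show E →ₗ[ℝ] ℝ from lam)
  obtain ⟨γ, u, r, hγ0, hu, hlip, hae⟩ :=
    exists_normal_extremal I (N := N) S.norm_definite W.subtypeL Λ g
  refine ⟨γ, hγ0, u, ⟨ordConnected_univ, isLocallyACOn_univ hlip, ?_⟩, fun a b => ⟨?_, ?_⟩, ?_⟩
  · rw [Measure.restrict_univ]
    filter_upwards [hae] with t ht using ht.2.1.hasMFDerivAt
  · exact hu.aestronglyMeasurable
  · have hm : StronglyMeasurable fun t => N (u t) :=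
      N.continuous_of_finiteDimensional_real.comp_stronglyMeasurable hu
    have : IsFiniteMeasure (volume.restrict (univ ∩ Icc a b)) := by
      rw [univ_inter]
      infer_instance
    refine MemLp.of_bound hm.aestronglyMeasurable r (ae_restrict_of_ae ?_)
    filter_upwards [hae] with t ht
    exact (abs_of_nonneg (apply_nonneg N (u t))).trans_le ht.1
  · rw [Measure.restrict_univ]
    filter_upwards [hae] with t ht v
    exact le_of_eq_of_le (congrArg lam (lieAd_eq_chartAd I (γ t) _)) (ht.2.2 v)
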